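/- Conventions. Let $H$ be a monoid with identity $1_H$. For $x,y\in H$ write $x\vdash_H y$ if $y\in xH$, $x\dashv_H y$ if $y\in Hx$, and $x\mid_H y$ if $y\in HxH$; these are preorders on $H$. A preorder $\preceq$ on a set $X$ is *artinian* if for every sequence $(x_k)_{k\ge 0}$ in $X$ with $x_{k+1}\preceq x_k$ for all $k$ there is $k'\in\mathbb N$ with $x_k\preceq x_{k+1}$ for all $k\ge k'$. We write $x\prec y$ if $x\preceq y$ and $y\not\preceq x$. For a preorder $\preceq$ on $H$, an element $u \in H$ is a *$\preceq$-unit* if $u\preceq 1_H\preceq u$, and a *$\preceq$-non-unit* otherwise. A $\preceq$-non-unit $a\in H$ is a *$\preceq$-irreducible* if $a\ne xy$ for all $\preceq$-non-units $x,y \in H$ with $x\prec a$ and $y\prec a$; a *$\preceq$-atom* if $a\neq xy$ for all $\preceq$-non-units $x,y \in H$; a *$\preceq$-quark* if there is no $\preceq$-non-unit $b \in H$ with $b\prec a$. $H$ is *$\preceq$-factorable* (resp. *$\preceq$-atomic*) if every $\preceq$-non-unit is a non-empty finite product of $\preceq$-irreducibles (resp. $\preceq$-atoms). $H$ is *reduced*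 if $1_H$ is its only unit; *cancellative* if $xz\ne yz$ and $zx\neq zy$ for all $x,y,z\in H$ with $x\ne y$; *acyclic* if $uxv\neq x$ for all $u,v,x\in H$ such that $u$ or $v$ is a non-unit. $H$ satisfies the *ACCP* if there is no infinite sequence of principal ideals $HxH$ ($x\in H$) that is strictly increasing with respect to inclusion. Statement. Let $n\ge 1$ be an integer and let $H=\mathrm{Mon}\langle a,b\mid b^n=ab^na\rangle$ be the quotient of the free monoid on the two-element set $\{a,b\}$ by the smallest monoid congruence identifying $b^n$ with $ab^na$. Then: 1. $H$ is reduced, finitely generated, cancellative and non-commutative, but it is not acyclic; and $1_H$ is the only $\mid_H$-unit of $H$. 2. $H$ is $\mid_H$-factorable. 3. None of the preorders $\vdash_H$, $\dashv_H$, $\mid_H$ is artinian; in particular, $H$ does not satisfy the ACCP. 4. $H$ is $\mid_H$-atomic if and only if $n\ge 2$. Moreover, $a$ is a $\mid_H$-atom; and if $n\ge 2$, then $b$ is a $\mid_H$-atom, too. 5. If $n=1$, then $b$ is a $\mid_H$-irreducible, but neither a $\mid_H$-atom nor a $\mid_H$-quark. -/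

import Mathlib

/-! Monoids equipped with a preorder. A preorder on `H` is handled as a relation
`r : H → H → Prop`; the three divisibility relations are shown below to be preorders. -/

namespace PreorderedFactorization

section Relations

/-- `x ≺ y`, that is, `x ≼ y` and not `y ≼ x`. -/
def Strict {X : Type*} (r : X → X → Prop) (x y : X) : Prop :=
  r x y ∧ ¬ r y x

/-- The descending chain condition: every non-increasing sequence is eventually constant
up to equivalence. -/
def Artinian {X : Type*} (r : X → X → Prop) : Prop :=
  ∀ x : ℕ → X, (∀ k, r (x (k + 1)) (x k)) → ∃ k₀, ∀ k, k₀ ≤ k → r (x k) (x (k + 1))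

variable {H : Type*} [Monoid H]

/-- A `≼`-unit is an element that is `≼`-equivalent to the identity. -/
def RUnit (r : H → H → Prop) (u : H) : Prop :=
  r u 1 ∧ r 1 u

/-- `≼`-irreducible elements. -/
def RIrreducible (r : H → H → Prop) (a : H) : Prop :=
  ¬ RUnit r a ∧
    ∀ x y : H, ¬ RUnit r x → ¬ RUnit r y → Strict r x a → Strict r y a → a ≠ x * y

/-- `≼`-atoms. -/
def RAtom (r : H → H → Prop) (a : H) : Prop :=
  ¬ RUnit r a ∧ ∀ x y : H, ¬ RUnit r x → ¬ RUnit r y → a ≠ x * y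

/-- `≼`-quarks. -/
def RQuark (r : H → H → Prop) (a : H) : Prop :=
  ¬ RUnit r a ∧ ¬ ∃ b : H, ¬ RUnit r b ∧ Strict r b a

/-- Every `≼`-non-unit is a non-empty finite product of `≼`-irreducibles. -/
def RFactorable (r : H → H → Prop) : Prop :=
  ∀ x : H, ¬ RUnit r x → ∃ l : List H, l ≠ [] ∧ (∀ y ∈ l, RIrreducible r y) ∧ l.prod = x

/-- Every `≼`-non-unit is a non-empty finite product of `≼`-atoms. -/
def RAtomic (r : H → H → Prop) : Prop :=
  ∀ x : H, ¬ RUnit r x → ∃ l : List H, l ≠ [] ∧ (∀ y ∈ l, RAtom r y) ∧ l.prod = x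

end Relations

section Divisibility

variable (H : Type*) [Monoid H]

/-- `x` divides `y` from the left: `y ∈ xH`. -/
def LeftDiv (x y : H) : Prop := ∃ v : H, y = x * v

/-- `x` divides `y` from the right: `y ∈ Hx`. -/
def RightDiv (x y : H) : Prop := ∃ u : H, y = u * x

/-- The divisibility relation: `y ∈ HxH`. -/
def Div (x y : H) : Prop := ∃ u v : H, y = u * x * v

theorem leftDiv_refl (x : H) : LeftDiv H x x := ⟨1, by simp⟩

theorem leftDiv_trans {x y z : H} (h : LeftDiv H x y) (h' : LeftDiv H y z) : LeftDiv H x z := by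
  obtain ⟨v, rfl⟩ := h
  obtain ⟨w, rfl⟩ := h'
  exact ⟨v * w, by simp [mul_assoc]⟩

theorem rightDiv_refl (x : H) : RightDiv H x x := ⟨1, by simp⟩

theorem rightDiv_trans {x y z : H} (h : RightDiv H x y) (h' : RightDiv H y z) :
    RightDiv H x z := by
  obtain ⟨v, rfl⟩ := h
  obtain ⟨w, rfl⟩ := h'
  exact ⟨w * v, by simp [mul_assoc]⟩

theorem div_refl (x : H) : Div H x x := ⟨1, 1, by simp⟩

theorem div_trans {x y z : H} (h : Div H x y) (h' : Div H y z) : Div H x z := by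
  obtain ⟨u, v, rfl⟩ := h
  obtain ⟨s, t, rfl⟩ := h'
  exact ⟨s * u, v * t, by simp [mul_assoc]⟩

/-- The only unit is the identity. -/
def Reduced : Prop := ∀ u : H, IsUnit u → u = 1

/-- `u x v ≠ x` whenever `u` or `v` is a non-unit. -/
def Acyclic : Prop := ∀ u v x : H, ¬ IsUnit u ∨ ¬ IsUnit v → u * x * v ≠ x

/-- The principal ideal `HaH`. -/
def principalIdeal (a : H) : Set H := {y | ∃ u v : H, y = u * a * v}

/-- The ascending chain condition on principal ideals: no infinite sequence of principal
ideals is strictly increasing with respect to inclusion. -/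
def ACCP : Prop :=
  ¬ ∃ I : ℕ → Set H, (∀ k, ∃ a : H, I k = principalIdeal H a) ∧ ∀ k, I k ⊂ I (k + 1)

end Divisibility

section Presentation

/-- The two-element alphabet. -/
inductive Letter : Type
  | a : Letter
  | b : Letter

/-- The one-element relation `{(bⁿ, a bⁿ a)}` on the free monoid on two letters. -/
def definingRel (n : ℕ) (u v : FreeMonoid Letter) : Prop :=
  u = FreeMonoid.of Letter.b ^ n ∧
    v = FreeMonoid.of Letter.a * FreeMonoid.of Letter.b ^ n * FreeMonoid.of Letter.a

/-- The monoid `Mon⟨a, b ∣ bⁿ = a bⁿ a⟩`: the quotient of the free monoid by the smallest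
monoid congruence containing the defining relation. -/
abbrev Mon (n : ℕ) : Type := PresentedMonoid (definingRel n)

/-- The class of the letter `a`. -/
def genA (n : ℕ) : Mon n := PresentedMonoid.of (definingRel n) Letter.a

/-- The class of the letter `b`. -/
def genB (n : ℕ) : Mon n := PresentedMonoid.of (definingRel n) Letter.b

end Presentation

end PreorderedFactorization

namespace PreorderedFactorization

/-! ### Words, induction and homomorphisms out of the presentation -/

namespace Mon

variable {n : ℕ}

/-! Three devices carry the proof. Homomorphisms to `ZMod 4` with generators sent to `0` or `2` show
that only `1` divides `1`, and that an element of value `2` is an atom, as a product of two even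
values is `0`. The number of `b`s is invariant, since both sides of the relation contain `n` of
them.

For cancellativity, the relation formally says that `b ^ n` conjugates `a` to its inverse, so `b ^
(2 * n)` commutes with `a`. Multiples of `2 * n` can be moved to the front, and the remaining rule
`a * b ^ n * a = b ^ n` yields normal forms. The monoid acts on them by injective maps, the normal
form of `1` has a faithful orbit, and the relation is a palindrome: this gives cancellation on both
sides.

The elements `b ^ n * a ^ k * b ^ n` form a strictly descending divisibility chain. For `n = 1`, `b
= a * (b * a)` prevents any element containing `b` from being an atom, while one factor in any
splitting of `b` is again divisible by `b`. -/

theorem genB_pow_eq (n : ℕ) : genB n ^ n = genA n * genB n ^ n * genA n :=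
  PresentedMonoid.mk_eq_mk_of_rel (rels := definingRel n) ⟨rfl, rfl⟩

@[elab_as_elim]
theorem induction {P : Mon n → Prop} (one : P 1) (mul_a : ∀ u, P u → P (genA n * u))
    (mul_b : ∀ u, P u → P (genB n * u)) (u : Mon n) : P u := by
  obtain ⟨w, rfl⟩ := PresentedMonoid.surjective_mk u
  induction w using FreeMonoid.inductionOn' with
  | one => exact one
  | of_mul c w ih =>
    cases c
    · exact mul_a _ ih
    · exact mul_b _ ih

/-- The homomorphism sending the generators to a pair `x`, `y` with `yⁿ = x yⁿ x`. -/
def lift {M : Type*} [Monoid M] (n : ℕ) (x y : M) (h : y ^ n = x * y ^ n * x) : Mon n →* M :=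
  PresentedMonoid.lift (rels := definingRel n) (fun | Letter.a => x | Letter.b => y) (by
    rintro _ _ ⟨rfl, rfl⟩
    simpa using h)

theorem exists_list_prod (u : Mon n) :
    ∃ l : List (Mon n), (∀ y ∈ l, y = genA n ∨ y = genB n) ∧ l.prod = u := by
  induction u using Mon.induction with
  | one => exact ⟨[], by simp⟩
  | mul_a u ih =>
    obtain ⟨l, hl, rfl⟩ := ih
    exact ⟨genA n :: l, by simpa using hl, by simp⟩
  | mul_b u ih =>
    obtain ⟨l, hl, rfl⟩ := ih
    exact ⟨genB n :: l, by simpa using hl, by simp⟩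

theorem fg (n : ℕ) : Monoid.FG (Mon n) := by
  refine Monoid.fg_iff.2 ⟨{genA n, genB n}, ?_, by simp⟩
  rw [Submonoid.eq_top_iff']
  intro u
  obtain ⟨l, hl, rfl⟩ := exists_list_prod u
  exact Submonoid.list_prod_mem _ fun y hy => Submonoid.subset_closure (hl y hy)

/-! ### Units and atoms via `ZMod 4` -/

section Units

/-- A homomorphism to `ZMod 4` sending both generators to `0` or `2` takes only these values
away from the identity. -/
theorem eq_one_or_map_eq (f : Mon n →* ZMod 4) (ha : f (genA n) = 0 ∨ f (genA n) = 2)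
    (hb : f (genB n) = 0 ∨ f (genB n) = 2) (u : Mon n) : u = 1 ∨ f u = 0 ∨ f u = 2 := by
  have key : ∀ s t : ZMod 4, (s = 0 ∨ s = 2) → (t = 1 ∨ t = 0 ∨ t = 2) →
      s * t = 0 ∨ s * t = 2 := by decide
  induction u using Mon.induction with
  | one => exact Or.inl rfl
  | mul_a u ih =>
    right
    rw [map_mul]
    exact key _ _ ha (ih.imp_left fun h => by simp [h])
  | mul_b u ih =>
    right
    rw [map_mul]
    exact key _ _ hb (ih.imp_left fun h => by simp [h])

/-- The homomorphism to `ZMod 4` with `a ↦ 2` and `b ↦ 0`. -/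
def parityA (hn : 1 ≤ n) : Mon n →* ZMod 4 :=
  lift n 2 0 (by rw [zero_pow (by omega)]; simp)

/-- The homomorphism to `ZMod 4` with `a ↦ 0` and `b ↦ 2`. -/
def parityB (hn : 2 ≤ n) : Mon n →* ZMod 4 :=
  lift n 0 2 (by
    obtain ⟨m, rfl⟩ := Nat.exists_eq_add_of_le hn
    rw [pow_add, show (2 : ZMod 4) ^ 2 = 0 from rfl]
    simp)

/-- If `u ≠ 1`, its image in `ZMod 4` is even, and so is that of every multiple of `u`, whereas `1`
is odd. -/
theorem eq_one_of_mul_eq_one (hn : 1 ≤ n) {x u y : Mon n} (h : x * u * y = 1) : u = 1 := by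
  by_contra hu
  have hu := (eq_one_or_map_eq (parityA hn) (Or.inr rfl) (Or.inl rfl) u).resolve_left hu
  have h : parityA hn x * parityA hn u * parityA hn y = 1 := by
    rw [← map_mul, ← map_mul, h, map_one]
  have key : ∀ r s t : ZMod 4, (s = 0 ∨ s = 2) → r * s * t ≠ 1 := by decide
  exact key _ _ _ hu h

theorem rUnit_iff (hn : 1 ≤ n) (u : Mon n) : RUnit (Div (Mon n)) u ↔ u = 1 := by
  constructor
  · rintro ⟨⟨x, y, h⟩, -⟩
    exact eq_one_of_mul_eq_one hn h.symm
  · rintro rfl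
    exact ⟨div_refl _ 1, div_refl _ 1⟩

theorem reduced (hn : 1 ≤ n) : Reduced (Mon n) := by
  intro u hu
  obtain ⟨v, hv⟩ := hu.exists_right_inv
  exact eq_one_of_mul_eq_one hn (x := 1) (y := v) (by simpa using hv)

/-- Non-units have value `0` or `2`, so a product of two of them has value `0`, not `2`. -/
theorem rAtom_of_map_eq_two (hn : 1 ≤ n) (f : Mon n →* ZMod 4)
    (ha : f (genA n) = 0 ∨ f (genA n) = 2) (hb : f (genB n) = 0 ∨ f (genB n) = 2) {c : Mon n}
    (hc : f c = 2) : RAtom (Div (Mon n)) c := by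
  refine ⟨fun h => ?_, fun x y hx hy h => ?_⟩
  · rw [rUnit_iff hn] at h
    rw [h, map_one] at hc
    exact absurd hc (by decide)
  · rw [rUnit_iff hn] at hx hy
    have hx := (eq_one_or_map_eq f ha hb x).resolve_left hx
    have hy := (eq_one_or_map_eq f ha hb y).resolve_left hy
    rw [h, map_mul] at hc
    have key : ∀ s t : ZMod 4, (s = 0 ∨ s = 2) → (t = 0 ∨ t = 2) → s * t ≠ 2 := by decide
    exact key _ _ hx hy hc

theorem rAtom_genA (hn : 1 ≤ n) : RAtom (Div (Mon n)) (genA n) :=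
  rAtom_of_map_eq_two hn (parityA hn) (Or.inr rfl) (Or.inl rfl) rfl

theorem rAtom_genB (hn : 2 ≤ n) : RAtom (Div (Mon n)) (genB n) :=
  rAtom_of_map_eq_two (by omega) (parityB hn) (Or.inl rfl) (Or.inr rfl) rfl

theorem genA_ne_one (hn : 1 ≤ n) : genA n ≠ 1 :=
  fun h => (rAtom_genA hn).1 ((rUnit_iff hn _).2 h)

theorem mul_ne_one_left (hn : 1 ≤ n) {x : Mon n} (hx : x ≠ 1) (y : Mon n) : x * y ≠ 1 :=
  fun h => hx (eq_one_of_mul_eq_one hn (x := 1) (y := y) (by simpa using h))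

theorem mul_ne_one_right (hn : 1 ≤ n) {x : Mon n} (hx : x ≠ 1) (y : Mon n) : y * x ≠ 1 :=
  fun h => hx (eq_one_of_mul_eq_one hn (x := y) (y := 1) (by simpa using h))

theorem not_acyclic (hn : 1 ≤ n) : ¬ Acyclic (Mon n) := fun h =>
  h (genA n) (genA n) (genB n ^ n) (Or.inl fun hu => genA_ne_one hn (reduced hn _ hu))
    (genB_pow_eq n).symm

end Units

/-! ### The number of occurrences of `b` -/

section Count

/-- The number of occurrences of `b`. -/
def countB (n : ℕ) : Mon n →* Multiplicative ℕ :=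
  lift n 1 (Multiplicative.ofAdd 1) (by simp)

theorem countB_genA : (countB n (genA n)).toAdd = 0 := rfl

theorem countB_genB : (countB n (genB n)).toAdd = 1 := rfl

theorem countB_mul (u v : Mon n) :
    (countB n (u * v)).toAdd = (countB n u).toAdd + (countB n v).toAdd := by simp

theorem eq_genA_pow_or_exists (u : Mon n) :
    (∃ i, u = genA n ^ i) ∨ ∃ x y, u = x * genB n * y := by
  induction u using Mon.induction with
  | one => exact Or.inl ⟨0, by simp⟩
  | mul_a u ih =>
    rcases ih with ⟨i, rfl⟩ | ⟨x, y, rfl⟩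
    · exact Or.inl ⟨i + 1, (pow_succ' _ _).symm⟩
    · exact Or.inr ⟨genA n * x, y, by simp [mul_assoc]⟩
  | mul_b u ih => exact Or.inr ⟨1, u, by simp⟩

theorem eq_genA_pow_of_countB_eq_zero {u : Mon n} (h : (countB n u).toAdd = 0) :
    ∃ i, u = genA n ^ i := by
  refine (eq_genA_pow_or_exists u).resolve_right ?_
  rintro ⟨x, y, rfl⟩
  rw [countB_mul, countB_mul, countB_genB] at h
  omega

theorem countB_genA_pow (i : ℕ) : (countB n (genA n ^ i)).toAdd = 0 := by
  rw [map_pow, toAdd_pow, countB_genA, smul_zero]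

theorem countB_genB_pow (i : ℕ) : (countB n (genB n ^ i)).toAdd = i := by
  rw [map_pow, toAdd_pow, countB_genB, smul_eq_mul, mul_one]

end Count

/-! ### Normal forms and left cancellation -/

section NormalForm

/-- The exponents `k₁, …, kₘ` in a normal form `b ^ k₀ * a * b ^ k₁ * ⋯ * a * b ^ kₘ`: they are all
less than `2n`, and only the last one may be equal to `n`. -/
def IsTail (n : ℕ) : List ℕ → Prop
  | [] => True
  | k :: l => k < 2 * n ∧ (k = n → l = []) ∧ IsTail n l

/-- Normal forms `b ^ k₀ * a * b ^ k₁ * ⋯ * a * b ^ kₘ`. -/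
def NormalForm (n : ℕ) : Type := {p : ℕ × List ℕ // IsTail n p.2}

/-- Left multiplication by `a` on normal forms, on the underlying lists of exponents. -/
def consA (n : ℕ) : ℕ × List ℕ → ℕ × List ℕ
  | (k, []) => (2 * n * (k / (2 * n)), [k % (2 * n)])
  | (k, i :: l) =>
    if k % (2 * n) = n then (k + i, l) else (2 * n * (k / (2 * n)), k % (2 * n) :: i :: l)

theorem isTail_consA (hn : 1 ≤ n) {p : ℕ × List ℕ} (hp : IsTail n p.2) :
    IsTail n (consA n p).2 := by
  have hmod (k : ℕ) : k % (2 * n) < 2 * n := Nat.mod_lt _ (by omega)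
  obtain ⟨k, _ | ⟨i, l⟩⟩ := p
  · exact ⟨hmod k, fun _ => rfl, trivial⟩
  · simp only [consA]
    split_ifs with h
    · exact hp.2.2
    · exact ⟨hmod k, fun h' => absurd h' h, hp⟩

theorem consA_injective {p q : ℕ × List ℕ} (hp : IsTail n p.2) (hq : IsTail n q.2)
    (h : consA n p = consA n q) : p = q := by
  obtain ⟨k, l⟩ := p
  obtain ⟨k', l'⟩ := q
  have hk := Nat.div_add_mod k (2 * n)
  have hk' := Nat.div_add_mod k' (2 * n)
  -- A merged head exponent is a multiple of `2n`, like an unmerged one, only if `i = n`; then the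
  -- tail left after merging is empty, whereas an unmerged result has a nonempty tail.
  have merged_ne {c r q i : ℕ} {l : List ℕ} (h : 2 * n * c = 2 * n * q + r + i) (hr : r = n)
      (hi : i < 2 * n) (h' : i = n → l = []) : l = [] := by
    apply h'
    have h1 : (2 * n * c) % (2 * n) = 0 := Nat.mul_mod_right _ _
    rw [h, hr, add_assoc, Nat.mul_add_mod] at h1
    obtain h2 | h2 := lt_or_ge (n + i) (2 * n)
    · rw [Nat.mod_eq_of_lt h2] at h1
      omega
    · rw [Nat.mod_eq_sub_mod h2, Nat.mod_eq_of_lt (by omega)] at h1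
      omega
  rcases l with _ | ⟨i, l⟩ <;> rcases l' with _ | ⟨i', l'⟩
  · simp only [consA, Prod.mk.injEq, List.cons.injEq] at h
    rw [← hk, ← hk', h.1, h.2.1]
  · simp only [consA] at h
    split_ifs at h with h'
    · simp only [Prod.mk.injEq] at h
      obtain ⟨h1, rfl⟩ := h
      rw [← hk'] at h1
      exact absurd (merged_ne h1 h' hq.1 hq.2.1) (by simp)
    · simp at h
  · simp only [consA] at h
    split_ifs at h with h'
    · simp only [Prod.mk.injEq] at h
      obtain ⟨h1, rfl⟩ := h
      rw [← hk] at h1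
      exact absurd (merged_ne h1.symm h' hp.1 hp.2.1) (by simp)
    · simp at h
  · simp only [consA] at h
    split_ifs at h with h1 h2 h2
    · simp only [Prod.mk.injEq] at h
      obtain ⟨h3, rfl⟩ := h
      -- Both `k` and `k'` are `n` modulo `2n`; adding `n` recovers `i` and `i'` as remainders of
      -- the common sum.
      have hi : i = i' := by
        have : (k + i + n) % (2 * n) = (k' + i' + n) % (2 * n) := by rw [h3]
        have e1 : k + i + n = i + 2 * n * (k / (2 * n) + 1) := by
          rw [h1] at hk; rw [mul_add]; omega
        have e2 : k' + i' + n = i' + 2 * n * (k' / (2 * n) + 1) := by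
          rw [h2] at hk'; rw [mul_add]; omega
        rwa [e1, e2, Nat.add_mul_mod_self_left, Nat.add_mul_mod_self_left,
          Nat.mod_eq_of_lt hp.1, Nat.mod_eq_of_lt hq.1] at this
      subst hi
      rw [Nat.add_right_cancel h3]
    · simp only [Prod.mk.injEq] at h
      obtain ⟨h3, rfl⟩ := h
      rw [← hk] at h3
      exact absurd (merged_ne h3.symm h1 hp.1 hp.2.1) (by simp)
    · simp only [Prod.mk.injEq] at h
      obtain ⟨h3, rfl⟩ := h
      rw [← hk'] at h3
      exact absurd (merged_ne h3 h2 hq.1 hq.2.1) (by simp)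
    · simp only [Prod.mk.injEq, List.cons.injEq] at h
      obtain ⟨h3, h4, rfl, rfl⟩ := h
      rw [← hk, ← hk', h3, h4]

/-- The relation `a bⁿ a = bⁿ` holds for the operations on normal forms. -/
theorem consA_add_consA (hn : 1 ≤ n) {p : ℕ × List ℕ} (hp : IsTail n p.2) :
    consA n ((consA n p).1 + n, (consA n p).2) = (p.1 + n, p.2) := by
  have hmod (c : ℕ) : (2 * n * c + n) % (2 * n) = n := by
    rw [Nat.mul_add_mod, Nat.mod_eq_of_lt (by omega)]
  obtain ⟨k, l⟩ := p
  have hk := Nat.div_add_mod k (2 * n)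
  rcases l with _ | ⟨i, l⟩
  · simp only [consA, hmod, if_true, Prod.mk.injEq, and_true]
    omega
  -- If the first `a` merged, adding `n` leaves remainder `i`, and `i ≠ n` unless it is last, so the
  -- second `a` splits the block off again. Otherwise the head is a multiple of `2n`, adding `n`
  -- forces a merge, and this undoes the first step.
  · by_cases h : k % (2 * n) = n
    · have e : k + i + n = 2 * n * (k / (2 * n) + 1) + i := by
        rw [h] at hk; rw [mul_add]; omega
      have hi : (k + i + n) % (2 * n) = i := by
        rw [e, Nat.mul_add_mod, Nat.mod_eq_of_lt hp.1]
      have hd : 2 * n * ((k + i + n) / (2 * n)) = k + n := by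
        have := Nat.div_add_mod (k + i + n) (2 * n)
        omega
      simp only [consA, h, if_true]
      rcases l with _ | ⟨j, l⟩
      · simp only [hi, hd]
      · have : i ≠ n := fun h' => absurd (hp.2.1 h') (by simp)
        simp only [hi, hd, if_neg this]
    · simp only [consA, if_neg h, hmod, if_true, Prod.mk.injEq, and_true]
      omega

/-- Left multiplication by `a` on normal forms. -/
def actA (hn : 1 ≤ n) : Function.End (NormalForm n) :=
  fun p => ⟨consA n p.1, isTail_consA hn p.2⟩

/-- Left multiplication by `b` on normal forms. -/
def actB (n : ℕ) : Function.End (NormalForm n) :=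
  fun p => ⟨(p.1.1 + 1, p.1.2), p.2⟩

theorem actB_pow (m : ℕ) (p : NormalForm n) : (actB n ^ m) p = ⟨(p.1.1 + m, p.1.2), p.2⟩ := by
  induction m with
  | zero => rfl
  | succ m ih =>
    rw [pow_succ']
    change actB n ((actB n ^ m) p) = _
    rw [ih]
    rfl

/-- The action of the monoid on normal forms by left multiplication. -/
def act (hn : 1 ≤ n) : Mon n →* Function.End (NormalForm n) :=
  lift n (actA hn) (actB n) (by
    funext p
    change (actB n ^ n) p = actA hn ((actB n ^ n) (actA hn p))
    rw [actB_pow, actB_pow]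
    exact Subtype.ext (consA_add_consA hn p.2).symm)

theorem act_injective (hn : 1 ≤ n) (u : Mon n) : Function.Injective (act hn u) := by
  induction u using Mon.induction with
  | one => exact fun _ _ h => h
  | mul_a u ih =>
    rw [map_mul]
    refine Function.Injective.comp (g := actA hn) (fun p q h => Subtype.ext ?_) ih
    exact consA_injective p.2 q.2 (congrArg Subtype.val h)
  | mul_b u ih =>
    rw [map_mul]
    refine Function.Injective.comp (g := actB n) (fun p q h => Subtype.ext ?_) ih
    have h : (p.1.1 + 1, p.1.2) = (q.1.1 + 1, q.1.2) := congrArg Subtype.val h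
    simp only [Prod.mk.injEq, add_left_inj] at h
    exact Prod.ext h.1 h.2

/-- Expand the second `b ^ n` as `a * b ^ n * a`, then contract the `a * b ^ n * a` on the left. -/
theorem commute_genA_genB_pow (n : ℕ) : Commute (genA n) (genB n ^ (2 * n)) := by
  have h := genB_pow_eq n
  change genA n * genB n ^ (2 * n) = genB n ^ (2 * n) * genA n
  rw [two_mul, pow_add]
  calc genA n * (genB n ^ n * genB n ^ n)
      = genA n * (genB n ^ n * (genA n * genB n ^ n * genA n)) := by rw [← h]
    _ = (genA n * genB n ^ n * genA n) * genB n ^ n * genA n := by simp only [mul_assoc]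
    _ = genB n ^ n * genB n ^ n * genA n := by rw [← h]

/-- The element represented by a list of exponents. -/
def eval (n : ℕ) (p : ℕ × List ℕ) : Mon n :=
  genB n ^ p.1 * (p.2.map fun i => genA n * genB n ^ i).prod

theorem eval_consA (p : ℕ × List ℕ) : eval n (consA n p) = genA n * eval n p := by
  have main (k : ℕ) (w : Mon n) :
      genB n ^ (2 * n * (k / (2 * n))) * (genA n * genB n ^ (k % (2 * n)) * w) =
        genA n * (genB n ^ k * w) := by
    have hc : Commute (genA n) (genB n ^ (2 * n * (k / (2 * n)))) := by
      rw [pow_mul]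
      exact (commute_genA_genB_pow n).pow_right _
    conv_rhs => rw [← Nat.div_add_mod k (2 * n), pow_add]
    simp only [← mul_assoc]
    rw [hc.eq]
  obtain ⟨k, _ | ⟨i, l⟩⟩ := p
  · simpa [eval, consA] using main k 1
  · simp only [consA]
    split_ifs with h
    · have := main k (genA n * (genB n ^ i * (l.map fun i => genA n * genB n ^ i).prod))
      simp only [eval, List.map_cons, List.prod_cons, mul_assoc] at this ⊢
      rw [← this, h, ← mul_assoc (genB n ^ n), ← mul_assoc (genA n), ← mul_assoc (genA n),
        ← genB_pow_eq, ← mul_assoc, ← mul_assoc, ← pow_add, ← pow_add]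
      conv_lhs => rw [← Nat.div_add_mod k (2 * n), h, mul_assoc 2 n]
    · simpa [eval, mul_assoc] using
        main k (genA n * (genB n ^ i * (l.map fun i => genA n * genB n ^ i).prod))

/-- Evaluation intertwines the action with left multiplication, so acting on the empty form
determines `u`. -/
theorem eval_act (hn : 1 ≤ n) (u : Mon n) (p : NormalForm n) :
    eval n (act hn u p).1 = u * eval n p.1 := by
  induction u using Mon.induction with
  | one => rw [map_one, one_mul]; rfl
  | mul_a u ih =>
    rw [mul_assoc, ← ih, ← eval_consA, map_mul]
    rfl
  | mul_b u ih =>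
    rw [mul_assoc, ← ih, map_mul]
    change genB n ^ ((act hn u p).1.1 + 1) *
        ((act hn u p).1.2.map fun i => genA n * genB n ^ i).prod =
      genB n * (genB n ^ (act hn u p).1.1 * _)
    rw [pow_succ', mul_assoc]

/-- The normal form of the identity. -/
def emptyForm (n : ℕ) : NormalForm n := ⟨(0, []), trivial⟩

theorem eval_act_emptyForm (hn : 1 ≤ n) (u : Mon n) :
    eval n (act hn u (emptyForm n)).1 = u := by
  rw [eval_act]
  simp [eval, emptyForm]

theorem mul_left_cancel_of_one_le (hn : 1 ≤ n) {u x y : Mon n} (h : u * x = u * y) : x = y := by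
  rw [← eval_act_emptyForm hn x, ← eval_act_emptyForm hn y]
  congr 2
  apply act_injective hn u
  change (act hn u * act hn x) _ = (act hn u * act hn y) _
  rw [← map_mul, ← map_mul, h]

theorem genA_mul_genB_ne (hn : 1 ≤ n) : genA n * genB n ≠ genB n * genA n := by
  intro h
  have h : (act hn (genA n * genB n) (emptyForm n)).1.1 =
      (act hn (genB n * genA n) (emptyForm n)).1.1 := by rw [h]
  change 2 * n * ((0 + 1) / (2 * n)) = 2 * n * (0 / (2 * n)) + 1 at h
  rw [Nat.div_eq_of_lt (by omega), Nat.zero_div] at h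
  omega

end NormalForm

/-! ### Right cancellation by reversing words -/

section Reverse

/-- Reversal of words, as a homomorphism to the opposite monoid. -/
def reverseHom (n : ℕ) : Mon n →* (Mon n)ᵐᵒᵖ :=
  lift n (MulOpposite.op (genA n)) (MulOpposite.op (genB n)) (by
    rw [← MulOpposite.op_pow, ← MulOpposite.op_mul, ← MulOpposite.op_mul, ← mul_assoc,
      ← genB_pow_eq])

/-- Reversal of words. -/
def reverse (u : Mon n) : Mon n := (reverseHom n u).unop

theorem reverse_mul (u v : Mon n) : reverse (u * v) = reverse v * reverse u := by
  simp [reverse]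

theorem reverse_reverse (u : Mon n) : reverse (reverse u) = u := by
  induction u using Mon.induction with
  | one => simp [reverse]
  | mul_a u ih => rw [reverse_mul, reverse_mul, ih]; rfl
  | mul_b u ih => rw [reverse_mul, reverse_mul, ih]; rfl

theorem isCancelMul (hn : 1 ≤ n) : IsCancelMul (Mon n) where
  mul_left_cancel _ _ _ h := mul_left_cancel_of_one_le hn h
  mul_right_cancel u x y h := by
    rw [← reverse_reverse x, ← reverse_reverse y]
    congr 1
    apply mul_left_cancel_of_one_le hn (u := reverse u)
    rw [← reverse_mul, ← reverse_mul]
    exact congrArg reverse h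

end Reverse

/-! ### Failure of the chain conditions -/

section Chain

/-- The sequence `bⁿ aᵏ bⁿ`, which is strictly decreasing for divisibility. -/
def chain (n k : ℕ) : Mon n := genB n ^ n * genA n ^ k * genB n ^ n

theorem leftDiv_chain (k : ℕ) : LeftDiv (Mon n) (chain n (k + 1)) (chain n k) := by
  refine ⟨genA n, ?_⟩
  unfold chain
  rw [pow_succ, ← mul_assoc, mul_assoc _ (genA n), mul_assoc _ (_ * _), ← genB_pow_eq]

theorem rightDiv_chain (k : ℕ) : RightDiv (Mon n) (chain n (k + 1)) (chain n k) := by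
  refine ⟨genA n, ?_⟩
  unfold chain
  rw [pow_succ', ← mul_assoc, ← mul_assoc, ← mul_assoc, ← genB_pow_eq]

theorem genA_pow_mul_genB_pow_mul (i : ℕ) :
    genA n ^ i * genB n ^ n * genA n ^ i = genB n ^ n := by
  induction i with
  | zero => simp
  | succ i ih =>
    calc genA n ^ (i + 1) * genB n ^ n * genA n ^ (i + 1)
        = genA n ^ i * (genA n * genB n ^ n * genA n) * genA n ^ i := by
          conv_lhs => arg 2; rw [pow_succ']
          rw [pow_succ]
          simp only [mul_assoc]
      _ = genB n ^ n := by rw [← genB_pow_eq, ih]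

theorem not_div_chain (hn : 1 ≤ n) (k : ℕ) : ¬ Div (Mon n) (chain n k) (chain n (k + 1)) := by
  rintro ⟨u, v, h⟩
  have hchain (k : ℕ) : (countB n (chain n k)).toAdd = n + n := by
    unfold chain
    rw [countB_mul, countB_mul, countB_genA_pow, countB_genB_pow, add_zero]
  have hcount := congrArg (fun w => (countB n w).toAdd) h
  simp only [countB_mul, hchain] at hcount
  -- Both chain elements contain `2n` letters `b`, so the cofactors contain none.
  obtain ⟨i, rfl⟩ := eq_genA_pow_of_countB_eq_zero (u := u) (by omega)
  obtain ⟨j, rfl⟩ := eq_genA_pow_of_countB_eq_zero (u := v) (by omega)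
  have hmul (k : ℕ) : chain n k * genA n ^ k = genB n ^ (2 * n) := by
    unfold chain
    rw [mul_assoc, mul_assoc, ← mul_assoc (_ ^ k), genA_pow_mul_genB_pow_mul, ← pow_add, two_mul]
  -- Multiplying by `a ^ (k + 1)` collapses the left side to `b ^ (2n)` and leaves at least one
  -- surplus `a` on the right.
  have h' : genB n ^ (2 * n) * 1 = genB n ^ (2 * n) * genA n ^ (i + (j + 1)) := by
    calc genB n ^ (2 * n) * 1
        = genA n ^ i * chain n k * genA n ^ j * genA n ^ (k + 1) := by rw [← h, hmul, mul_one]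
      _ = genA n ^ i * (chain n k * genA n ^ k) * genA n ^ (j + 1) := by
          simp only [mul_assoc, ← pow_add]
          rw [show j + (k + 1) = k + (j + 1) by omega]
      _ = genB n ^ (2 * n) * genA n ^ (i + (j + 1)) := by
          rw [hmul, ((commute_genA_genB_pow n).pow_left i).eq, mul_assoc, ← pow_add]
  have h1 := mul_left_cancel_of_one_le hn h'
  rw [← add_assoc, pow_succ] at h1
  exact mul_ne_one_right hn (genA_ne_one hn) _ h1.symm

theorem div_of_leftDiv {H : Type*} [Monoid H] {x y : H} (h : LeftDiv H x y) : Div H x y := by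
  obtain ⟨v, rfl⟩ := h
  exact ⟨1, v, by simp⟩

theorem div_of_rightDiv {H : Type*} [Monoid H] {x y : H} (h : RightDiv H x y) : Div H x y := by
  obtain ⟨u, rfl⟩ := h
  exact ⟨u, 1, by simp⟩

theorem not_artinian_of_chain (hn : 1 ≤ n) {r : Mon n → Mon n → Prop}
    (hr : ∀ x y, r x y → Div (Mon n) x y) (h : ∀ k, r (chain n (k + 1)) (chain n k)) :
    ¬ Artinian r := by
  intro hart
  obtain ⟨k, hk⟩ := hart _ h
  exact not_div_chain hn k (hr _ _ (hk k le_rfl))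

theorem not_accp (hn : 1 ≤ n) : ¬ ACCP (Mon n) := by
  refine not_not_intro ⟨fun k => principalIdeal _ (chain n k), fun k => ⟨_, rfl⟩, fun k => ?_⟩
  refine Set.ssubset_iff_subset_ne.2 ⟨fun y hy => ?_, fun h => not_div_chain hn k ?_⟩
  · exact div_trans _ (div_of_leftDiv (leftDiv_chain k)) hy
  · have h : principalIdeal _ (chain n k) = principalIdeal _ (chain n (k + 1)) := h
    change chain n (k + 1) ∈ principalIdeal _ (chain n k)
    rw [h]
    exact div_refl _ _

end Chain

/-! ### Factorizations and the exceptional case `n = 1` -/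

section Factorization

theorem rIrreducible_of_rAtom {H : Type*} [Monoid H] {r : H → H → Prop} {c : H} (h : RAtom r c) :
    RIrreducible r c :=
  ⟨h.1, fun x y hx hy _ _ => h.2 x y hx hy⟩

theorem exists_factorization (hn : 1 ≤ n) {P : Mon n → Prop} (ha : P (genA n)) (hb : P (genB n))
    (x : Mon n) (hx : ¬ RUnit (Div (Mon n)) x) :
    ∃ l : List (Mon n), l ≠ [] ∧ (∀ y ∈ l, P y) ∧ l.prod = x := by
  obtain ⟨l, hl, rfl⟩ := exists_list_prod x
  refine ⟨l, ?_, fun y hy => ?_, rfl⟩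
  · rintro rfl
    exact hx ((rUnit_iff hn _).2 rfl)
  · rcases hl y hy with rfl | rfl
    · exact ha
    · exact hb

theorem genB_one_eq : genB 1 = genA 1 * genB 1 * genA 1 := by
  simpa using genB_pow_eq 1

theorem not_rAtom_mul_genB_mul (x y : Mon 1) : ¬ RAtom (Div (Mon 1)) (x * genB 1 * y) := by
  intro h
  refine h.2 (x * genA 1) (genB 1 * genA 1 * y) ?_ ?_ ?_
  · rw [rUnit_iff le_rfl]
    exact mul_ne_one_right le_rfl (genA_ne_one le_rfl) _
  · rw [rUnit_iff le_rfl]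
    exact mul_ne_one_left le_rfl (mul_ne_one_right le_rfl (genA_ne_one le_rfl) _) _
  · conv_lhs => rw [genB_one_eq]
    simp only [mul_assoc]

theorem countB_eq_zero_of_rAtom {x : Mon 1} (h : RAtom (Div (Mon 1)) x) :
    (countB 1 x).toAdd = 0 := by
  rcases eq_genA_pow_or_exists x with ⟨i, rfl⟩ | ⟨u, v, rfl⟩
  · exact countB_genA_pow i
  · exact absurd h (not_rAtom_mul_genB_mul u v)

theorem genB_one_ne_one : genB 1 ≠ 1 := fun h => by
  have : (countB 1 (genB 1)).toAdd = (countB 1 1).toAdd := by rw [h]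
  rw [countB_genB, map_one, toAdd_one] at this
  omega

theorem not_rAtomic_one : ¬ RAtomic (Div (Mon 1)) := by
  intro h
  obtain ⟨l, -, hl, hprod⟩ := h (genB 1) ((rUnit_iff le_rfl _).not.2 genB_one_ne_one)
  have key : ∀ l : List (Mon 1), (∀ y ∈ l, RAtom (Div (Mon 1)) y) →
      (countB 1 l.prod).toAdd = 0 := by
    intro l
    induction l with
    | nil => simp
    | cons y l ih =>
      intro hl
      rw [List.prod_cons, countB_mul, countB_eq_zero_of_rAtom (hl y (by simp)),
        ih fun z hz => hl z (by simp [hz])]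
  have := key l hl
  rw [hprod, countB_genB] at this
  omega

theorem rIrreducible_genB_one : RIrreducible (Div (Mon 1)) (genB 1) := by
  refine ⟨(rUnit_iff le_rfl _).not.2 genB_one_ne_one, fun x y _ _ hx hy h => ?_⟩
  -- A factor containing `b` is divisible by `b`, hence not strictly below it; two powers of `a`
  -- cannot produce a `b`.
  rcases eq_genA_pow_or_exists x with ⟨i, rfl⟩ | hx'
  · rcases eq_genA_pow_or_exists y with ⟨j, rfl⟩ | hy'
    · have := congrArg (fun w => (countB 1 w).toAdd) h
      simp only [countB_mul, countB_genA_pow, countB_genB] at this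
      omega
    · exact hy.2 hy'
  · exact hx.2 hx'

theorem rFactorable (hn : 1 ≤ n) : RFactorable (Div (Mon n)) := by
  refine exists_factorization hn (rIrreducible_of_rAtom (rAtom_genA hn)) ?_
  obtain rfl | h := hn.eq_or_lt
  · exact rIrreducible_genB_one
  · exact rIrreducible_of_rAtom (rAtom_genB h)

theorem rAtomic_iff (hn : 1 ≤ n) : RAtomic (Div (Mon n)) ↔ 2 ≤ n := by
  refine ⟨fun h => ?_, fun h => exists_factorization hn (rAtom_genA hn) (rAtom_genB h)⟩
  by_contra hlt
  obtain rfl : n = 1 := by omega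
  exact not_rAtomic_one h

theorem not_rQuark_genB_one : ¬ RQuark (Div (Mon 1)) (genB 1) := by
  refine fun h => h.2 ⟨genA 1, (rAtom_genA le_rfl).1, ?_, ?_⟩
  · exact ⟨1, genB 1 * genA 1, by simpa [mul_assoc] using genB_one_eq⟩
  · rintro ⟨u, v, h⟩
    have := congrArg (fun w => (countB 1 w).toAdd) h
    simp only [countB_mul, countB_genA, countB_genB] at this
    omega

end Factorization

end Mon

end PreorderedFactorization

theorem mainTheorem12 (n : ℕ) (hn : 1 ≤ n) :
    PreorderedFactorization.Reduced (PreorderedFactorization.Mon n) ∧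
    Monoid.FG (PreorderedFactorization.Mon n) ∧
    IsCancelMul (PreorderedFactorization.Mon n) ∧
    (∃ x y : PreorderedFactorization.Mon n, x * y ≠ y * x) ∧
    ¬ PreorderedFactorization.Acyclic (PreorderedFactorization.Mon n) ∧
    (∀ u : PreorderedFactorization.Mon n,
      PreorderedFactorization.RUnit
        (PreorderedFactorization.Div (PreorderedFactorization.Mon n)) u ↔ u = 1) ∧
    PreorderedFactorization.RFactorable
      (PreorderedFactorization.Div (PreorderedFactorization.Mon n)) ∧
    ¬ PreorderedFactorization.Artinian
      (PreorderedFactorization.LeftDiv (PreorderedFactorization.Mon n)) ∧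
    ¬ PreorderedFactorization.Artinian
      (PreorderedFactorization.RightDiv (PreorderedFactorization.Mon n)) ∧
    ¬ PreorderedFactorization.Artinian
      (PreorderedFactorization.Div (PreorderedFactorization.Mon n)) ∧
    ¬ PreorderedFactorization.ACCP (PreorderedFactorization.Mon n) ∧
    (PreorderedFactorization.RAtomic
      (PreorderedFactorization.Div (PreorderedFactorization.Mon n)) ↔ 2 ≤ n) ∧
    PreorderedFactorization.RAtom
      (PreorderedFactorization.Div (PreorderedFactorization.Mon n))
      (PreorderedFactorization.genA n) ∧
    (2 ≤ n → PreorderedFactorization.RAtom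
      (PreorderedFactorization.Div (PreorderedFactorization.Mon n))
      (PreorderedFactorization.genB n)) ∧
    (n = 1 →
      PreorderedFactorization.RIrreducible
        (PreorderedFactorization.Div (PreorderedFactorization.Mon n))
        (PreorderedFactorization.genB n) ∧
      ¬ PreorderedFactorization.RAtom
        (PreorderedFactorization.Div (PreorderedFactorization.Mon n))
        (PreorderedFactorization.genB n) ∧
      ¬ PreorderedFactorization.RQuark
        (PreorderedFactorization.Div (PreorderedFactorization.Mon n))
        (PreorderedFactorization.genB n)) := by
  open PreorderedFactorization PreorderedFactorization.Mon in
  exact ⟨reduced hn, fg n, isCancelMul hn, ⟨_, _, genA_mul_genB_ne hn⟩, not_acyclic hn,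
    rUnit_iff hn, rFactorable hn,
    not_artinian_of_chain hn (fun _ _ => div_of_leftDiv) leftDiv_chain,
    not_artinian_of_chain hn (fun _ _ => div_of_rightDiv) rightDiv_chain,
    not_artinian_of_chain hn (fun _ _ h => h) fun k => div_of_leftDiv (leftDiv_chain k),
    not_accp hn, rAtomic_iff hn, rAtom_genA hn, rAtom_genB, by
      rintro rfl
      exact ⟨rIrreducible_genB_one,
        by simpa using not_rAtom_mul_genB_mul 1 1, not_rQuark_genB_one⟩⟩
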